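/- Let $\Gamma_u=\{\sum_{i=0}^{n_u}a_is^i : a_i\in[a_i^-,a_i^+]\}$ and $\Gamma_v=\{\sum_{i=0}^{n_v}b_is^i : b_i\in[b_i^-,b_i^+]\}$ be real interval polynomial families with $n_u\le n_v$, and suppose that $\Gamma_v$ has fixed order $n_v$, i.e. $0\notin[b_{n_v}^-,b_{n_v}^+]$ (so every $p_u/p_v$ with $p_u\in\Gamma_u$, $p_v\in\Gamma_v$ is a proper transfer function). A polynomial is Hurwitz stable if all its complex roots lie in the open left half plane. A proper transfer function $p/q$, where $p,q$ are real polynomials, $q\neq 0$ and $\deg p\le\deg q$, is strictly positive real (SPR) if $q$ is Hurwitz stable and $\Re\frac{p(j\omega)}{q(j\omega)}>0$ for all $\omega\in\mathbb R$ (where $j^2=-1$); for $\gamma\in\mathbb R$, $\gamma+\frac pq$ denotes the transfer function $\frac{\gamma q+p}{q}$. The four Kharitonov polynomials of a family with coefficient intervals $[q_i^-,q_i^+]$, $0\le i\le n$, are obtained by taking as coefficients of $1,s,s^2,\dots,s^n$ the bounds whose signs follow, periodically with period four, the patterns $$K_1:(-,-,+,+),\quad K_2:(+,+,-,-),\quad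 K_3:(+,-,-,+),\quad K_4:(-,+,+,-).$$ Write $K_i^u$ and $K_i^v$ for those of $\Gamma_u$ and $\Gamma_v$. Then: 1. $\frac{p_u}{p_v}$ is SPR for all $p_u\in\Gamma_u$, $p_v\in\Gamma_v$ if and only if the eight vertex transfer functions $$\frac{K_1^u}{K_4^v},\ \frac{K_2^u}{K_3^v},\ \frac{K_3^u}{K_1^v},\ \frac{K_4^u}{K_2^v},\ \frac{K_1^u}{K_3^v},\ \frac{K_2^u}{K_4^v},\ \frac{K_3^u}{K_2^v},\ \frac{K_4^u}{K_1^v}$$ are SPR. 2. For every real $\gamma\ge 0$: $\gamma+\frac{p_u}{p_v}$ is SPR for all $p_u\in\Gamma_u$, $p_v\in\Gamma_v$ if and only if $\gamma+\frac{K_i^u}{K_j^v}$ is SPR for the eight vertices in 1 and the four vertices $\frac{K_1^u}{K_1^v},\frac{K_2^u}{K_2^v},\frac{K_3^u}{K_3^v},\frac{K_4^u}{K_4^v}$. 3. For every real $\gamma\le 0$: $\gamma+\frac{p_u}{p_v}$ is SPR for all $p_u\in\Gamma_u$, $p_v\in\Gamma_v$ if and only if $\gamma+\frac{K_i^u}{K_j^v}$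 is SPR for the eight vertices in 1 and the four vertices $\frac{K_1^u}{K_2^v},\frac{K_2^u}{K_1^v},\frac{K_3^u}{K_4^v},\frac{K_4^u}{K_3^v}$. -/

import Mathlib

open Polynomial

noncomputable section

/-- The real polynomial `∑_{i=0}^n q_i s^i` with coefficients `q_0, …, q_n`. -/
def polyOfCoeffs (n : ℕ) (q : ℕ → ℝ) : ℝ[X] :=
  ∑ i ∈ Finset.range (n + 1), C (q i) * X ^ i

/-- Data of an `n`-th order real interval polynomial family: the order `n` and the non-empty
coefficient intervals `[q_i⁻, q_i⁺]`, `i = 0, …, n`. -/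
structure RealIntervalFamily where
  order : ℕ
  lower : ℕ → ℝ
  upper : ℕ → ℝ
  lower_le_upper : ∀ i ≤ order, lower i ≤ upper i

namespace RealIntervalFamily

/-- The set of polynomials `∑_{i=0}^n q_i s^i` with `q_i ∈ [q_i⁻, q_i⁺]`. -/
def polys (Γ : RealIntervalFamily) : Set ℝ[X] :=
  {p | ∃ q : ℕ → ℝ, (∀ i ≤ Γ.order, q i ∈ Set.Icc (Γ.lower i) (Γ.upper i)) ∧
    p = polyOfCoeffs Γ.order q}

/-- First Kharitonov polynomial: bounds `-, -, +, +` repeated with period four. -/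
def K₁ (Γ : RealIntervalFamily) : ℝ[X] :=
  polyOfCoeffs Γ.order fun i => if i % 4 = 0 ∨ i % 4 = 1 then Γ.lower i else Γ.upper i

/-- Second Kharitonov polynomial: bounds `+, +, -, -` repeated with period four. -/
def K₂ (Γ : RealIntervalFamily) : ℝ[X] :=
  polyOfCoeffs Γ.order fun i => if i % 4 = 0 ∨ i % 4 = 1 then Γ.upper i else Γ.lower i

/-- Third Kharitonov polynomial: bounds `+, -, -, +` repeated with period four. -/
def K₃ (Γ : RealIntervalFamily) : ℝ[X] :=
  polyOfCoeffs Γ.order fun i => if i % 4 = 0 ∨ i % 4 = 3 then Γ.upper i else Γ.lower i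

/-- Fourth Kharitonov polynomial: bounds `-, +, +, -` repeated with period four. -/
def K₄ (Γ : RealIntervalFamily) : ℝ[X] :=
  polyOfCoeffs Γ.order fun i => if i % 4 = 0 ∨ i % 4 = 3 then Γ.lower i else Γ.upper i

end RealIntervalFamily

/-- Hurwitz stability: all complex roots lie in the open left half plane (so the zero polynomial
is not Hurwitz stable and a non-zero constant is). -/
def IsHurwitz (p : ℝ[X]) : Prop :=
  ∀ s : ℂ, aeval s p = 0 → s.re < 0

/-- The transfer function `p(s)/q(s)` is proper and strictly positive real. -/
def IsSPR (p q : ℝ[X]) : Prop :=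
  p.natDegree ≤ q.natDegree ∧ IsHurwitz q ∧
    ∀ ω : ℝ, 0 < (aeval (Complex.I * (ω : ℂ)) p / aeval (Complex.I * (ω : ℂ)) q).re

/-- The transfer function `γ + p(s)/q(s) = (γ q(s) + p(s))/q(s)` is strictly positive real. -/
def IsShiftedSPR (γ : ℝ) (p q : ℝ[X]) : Prop :=
  IsSPR (C γ * q + p) q

/-- The eight vertices `(K_i^u, K_j^v)` used for every shift. -/
def eightVertices (Γu Γv : RealIntervalFamily) : Set (ℝ[X] × ℝ[X]) :=
  {(Γu.K₁, Γv.K₄), (Γu.K₂, Γv.K₃), (Γu.K₃, Γv.K₁), (Γu.K₄, Γv.K₂),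
   (Γu.K₁, Γv.K₃), (Γu.K₂, Γv.K₄), (Γu.K₃, Γv.K₂), (Γu.K₄, Γv.K₁)}

/-- The twelve vertices used for non-negative shifts. -/
def twelveVerticesNonneg (Γu Γv : RealIntervalFamily) : Set (ℝ[X] × ℝ[X]) :=
  eightVertices Γu Γv ∪
    {(Γu.K₁, Γv.K₁), (Γu.K₂, Γv.K₂), (Γu.K₃, Γv.K₃), (Γu.K₄, Γv.K₄)}

/-- The twelve vertices used for non-positive shifts. -/
def twelveVerticesNonpos (Γu Γv : RealIntervalFamily) : Set (ℝ[X] × ℝ[X]) :=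
  eightVertices Γu Γv ∪
    {(Γu.K₁, Γv.K₂), (Γu.K₂, Γv.K₁), (Γu.K₃, Γv.K₄), (Γu.K₄, Γv.K₃)}

end

/-! The real part of γ + p_u/p_v vanishes at iω exactly when p_u(iω) + z p_v(iω) = 0 for some z with
Re z = γ, provided p_v(iω) ≠ 0. The problem is therefore one of zero exclusion for each fixed z. For
ω ≥ 0 the values of Γ_u and Γ_v at iω lie in axis-parallel rectangles whose corners are Kharitonov
polynomials. The values of p_u + z p_v then lie in the sum of one rectangle and z times another: an
octagon whose edge directions 1, z, i, iz, … do not depend on ω, and whose vertices are polynomials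
K_i^u + z K_j^v.

If K_i^u/K_j^v with shift γ is SPR, positivity extends from the imaginary axis to the closed right
half plane, so K_i^u + z K_j^v has no root there and its phase does not decrease along the axis. If
0 first enters the octagon through an edge, its endpoints lie on opposite sides of 0 and have the
same velocity normal to the edge. Turning in the same sense, they would need opposite normal
velocities, so both velocities vanish normally. Then both vertex polynomials are constant, which the
initial position excludes (`exists_separating_edge`).

The quadrant of z decides which pairs (i, j) occur. With corners numbered counterclockwise, the
pairs (k, k ± 1) give the eight common vertices, (k, k) occurs only for Re z > 0 and (k, k + 2) only
for Re z < 0. For imaginary z ≠ 0 the octagon degenerates to a rectangle, which is why eight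
vertices suffice at γ = 0.

The same exclusion for one rectangle gives Kharitonov's theorem, hence stability of every
denominator. A real part that is never zero and is positive at a vertex is positive on the whole
family, by the intermediate value theorem along a segment. -/

/-! ### Positivity and phase on the imaginary axis -/

/-- A proper rational function without poles in the closed right half plane whose real part is
positive on the imaginary axis has positive real part on the closed right half plane. -/
theorem re_div_pos_of_re_div_pos_on_imaginary_axis {N q : ℂ[X]} (hdeg : N.degree ≤ q.degree)
    (hq : ∀ s : ℂ, 0 ≤ s.re → q.eval s ≠ 0)
    (hpos : ∀ ω : ℝ, 0 < (N.eval (Complex.I * ω) / q.eval (Complex.I * ω)).re)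
    {s : ℂ} (hs : 0 ≤ s.re) : 0 < (N.eval s / q.eval s).re := by
  -- Positivity of Re(N/q) becomes the bound ‖f‖ ≤ 1, which Phragmén–Lindelöf carries from the axis
  -- into the half plane. Properness makes f bounded near infinity.
  set f : ℂ → ℂ := fun s => Complex.exp (-(N.eval s / q.eval s)) with hf
  have hnorm : ∀ s, ‖f s‖ = Real.exp (-(N.eval s / q.eval s).re) := fun s => by
    simp only [hf, Complex.norm_exp, Complex.neg_re]
  have hclosure : closure {z : ℂ | 0 < z.re} = {z : ℂ | 0 ≤ z.re} := Complex.closure_setOfPred_lt_re 0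
  have hd : DiffContOnCl ℂ f {z | 0 < z.re} := by
    apply DifferentiableOn.diffContOnCl
    rw [hclosure]
    intro z hz
    apply DifferentiableAt.differentiableWithinAt
    exact ((N.differentiableAt).div q.differentiableAt (hq z hz)).neg.cexp
  obtain ⟨M, hM⟩ := (Polynomial.isBigO_cobounded_of_degree_le hdeg).bound
  have hbound : ∀ᶠ z in Bornology.cobounded ℂ ⊓ Filter.principal {z : ℂ | 0 < z.re},
      ‖f z‖ ≤ Real.exp M := by
    filter_upwards [hM.filter_mono inf_le_left,
      Filter.mem_inf_of_right (Filter.mem_principal_self _)] with z hz hz'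
    rw [hnorm]
    apply Real.exp_le_exp.2
    have h1 : ‖N.eval z / q.eval z‖ ≤ M := by
      rw [norm_div, div_le_iff₀ (norm_pos_iff.2 (hq z (le_of_lt hz')))]
      exact hz
    have h2 := Complex.abs_re_le_norm (N.eval z / q.eval z)
    have h3 := neg_abs_le (N.eval z / q.eval z).re
    linarith
  have hle : ∀ z : ℂ, 0 ≤ z.re → ‖f z‖ ≤ 1 := by
    intro z hz
    refine PhragmenLindelof.right_half_plane_of_bounded_on_real hd
      -- Growth exponent and constant are both 0: f is O(1) at infinity.
      ⟨0, by norm_num, 0, ?_⟩ ?_ ?_ hz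
    · refine Asymptotics.IsBigO.of_bound (Real.exp M) ?_
      filter_upwards [hbound] with z hz
      simpa using hz
    · refine ⟨Real.exp M, ?_⟩
      have ht : Filter.Tendsto (fun x : ℝ => (x : ℂ)) Filter.atTop
          (Bornology.cobounded ℂ ⊓ Filter.principal {z : ℂ | 0 < z.re}) := by
        refine Filter.tendsto_inf.2 ⟨?_, ?_⟩
        · rw [← tendsto_norm_atTop_iff_cobounded]
          simpa using Filter.tendsto_abs_atTop_atTop
        · rw [Filter.tendsto_principal]
          filter_upwards [Filter.eventually_gt_atTop 0] with x hx
          simpa using hx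
      simpa using ht.eventually hbound
    · intro x
      rw [hnorm, mul_comm, Real.exp_le_one_iff]
      linarith [hpos x]
  have hnonneg : 0 ≤ (N.eval s / q.eval s).re := by
    have := hle s hs
    rw [hnorm, Real.exp_le_one_iff] at this
    linarith
  refine lt_of_le_of_ne hnonneg fun h0 => ?_
  rcases hs.eq_or_lt with hs0 | hs0
  · have h1 := hpos s.im
    have : Complex.I * s.im = s := by
      apply Complex.ext <;> simp [← hs0]
    rw [this] at h1
    linarith
  -- An interior zero of the real part makes ‖f‖ attain its maximum 1, so ‖f‖ is 1 up to the
  -- boundary, contradicting strict positivity at ω = 0.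
  · have hmax : IsMaxOn (norm ∘ f) {z | 0 < z.re} s := by
      intro z hz
      have h1 : ‖f s‖ = 1 := by rw [hnorm, ← h0]; simp
      simpa [h1] using hle z (le_of_lt hz)
    have := Complex.norm_eqOn_closure_of_isPreconnected_of_isMaxOn
      (convex_halfSpace_re_gt 0).isPreconnected
      (isOpen_lt continuous_const Complex.continuous_re) hd hs0 hmax
    have h2 := this (show (0 : ℂ) ∈ closure {z : ℂ | 0 < z.re} by rw [hclosure]; simp)
    simp only [Function.comp, Function.const, hnorm, Real.exp_eq_exp] at h2
    have h3 := hpos 0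
    simp only [Complex.ofReal_zero, mul_zero] at h3
    linarith

/-- The phase of a complex polynomial without roots in the closed right half plane is
non-decreasing along the imaginary axis, and increasing unless the polynomial is constant. -/
theorem im_derivative_mul_conj_nonneg_and_pos {F : ℂ[X]}
    (hF : ∀ s : ℂ, 0 ≤ s.re → F.eval s ≠ 0) (ω : ℝ) :
    0 ≤ (Complex.I * F.derivative.eval (Complex.I * ω) *
        (starRingEnd ℂ) (F.eval (Complex.I * ω))).im ∧
      (F.natDegree ≠ 0 → 0 < (Complex.I * F.derivative.eval (Complex.I * ω) *
        (starRingEnd ℂ) (F.eval (Complex.I * ω))).im) := by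
  have h0 : F.eval (Complex.I * ω) ≠ 0 := hF _ (by simp)
  have hF0 : F ≠ 0 := by rintro rfl; simp at h0
  have key : ∀ z ∈ F.roots, 0 < (1 / (Complex.I * ω - z)).re := by
    intro z hz
    have hz' : z.re < 0 := by
      by_contra! h
      exact hF z h (Polynomial.isRoot_of_mem_roots hz)
    have hre : 0 < (Complex.I * ω - z).re := by simpa using hz'
    rw [one_div, Complex.inv_re]
    apply div_pos hre
    rw [Complex.normSq_pos]
    rintro h
    rw [h] at hre
    simp at hre
  -- The quantity is |F|² Re(F'/F), and F'/F is the sum of 1/(iω - z) over the roots z, each term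
  -- having positive real part.
  have hsum : (Complex.I * F.derivative.eval (Complex.I * ω) *
        (starRingEnd ℂ) (F.eval (Complex.I * ω))).im =
      Complex.normSq (F.eval (Complex.I * ω)) *
        (F.roots.map fun z => (1 / (Complex.I * ω - z)).re).sum := by
    rw [(IsAlgClosed.splits F).eval_derivative_eq_eval_mul_sum h0]
    have hre : (F.roots.map fun z => (1 / (Complex.I * ω - z)).re).sum =
        ((F.roots.map fun z => 1 / (Complex.I * ω - z)).sum).re := by
      have := Multiset.sum_hom (F.roots.map fun z => 1 / (Complex.I * ω - z)) Complex.reAddGroupHom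
      simpa [Multiset.map_map] using this
    rw [hre]
    simp only [Complex.mul_im, Complex.mul_re, Complex.I_re, Complex.I_im, Complex.conj_re,
      Complex.conj_im, Complex.normSq_apply]
    ring
  rw [hsum]
  have hn := Complex.normSq_pos.2 h0
  constructor
  · apply mul_nonneg hn.le
    apply Multiset.sum_nonneg
    intro x hx
    obtain ⟨z, hz, rfl⟩ := Multiset.mem_map.1 hx
    exact (key z hz).le
  · intro hdeg
    apply mul_pos hn
    have hcard : F.roots ≠ 0 := by
      intro h
      apply hdeg
      rw [(IsAlgClosed.splits F).natDegree_eq_card_roots, h]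
      simp
    obtain ⟨z, hz⟩ := Multiset.exists_mem_of_ne_zero hcard
    obtain ⟨m, hm⟩ := Multiset.exists_cons_of_mem hz
    rw [hm, Multiset.map_cons, Multiset.sum_cons]
    apply add_pos_of_pos_of_nonneg (key z hz)
    apply Multiset.sum_nonneg
    intro x hx
    obtain ⟨w, hw, rfl⟩ := Multiset.mem_map.1 hx
    exact (key w (hm ▸ Multiset.mem_cons_of_mem hw)).le

/-! ### Zero exclusion for a moving polygon -/

/-- The zero exclusion principle for a moving polygon with vertices `W k (iω)` and fixed edge
directions `d k`: if no `W k` has a root in the closed right half plane and one edge line of the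
initial polygon separates `0` strictly from all its vertices, then for every `ω ≥ 0` some edge line
separates `0` strictly from the polygon. -/
theorem exists_separating_edge {n : ℕ} [NeZero n] (d : Fin n → ℂ) (W : Fin n → ℂ[X])
    (hW : ∀ k (s : ℂ), 0 ≤ s.re → (W k).eval s ≠ 0)
    (hd : ∀ k, 0 < ((starRingEnd ℂ) (d k) * d (k + 1)).im)
    (hedge : ∀ k (ω : ℝ), ((starRingEnd ℂ) (d k) * (W (k + 1)).eval (Complex.I * ω)).im =
      ((starRingEnd ℂ) (d k) * (W k).eval (Complex.I * ω)).im)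
    (h0 : ∃ j, ∀ k, 0 < ((starRingEnd ℂ) (d j) * (W k).eval 0).im)
    {ω : ℝ} (hω : 0 ≤ ω) : ∃ k, 0 < ((starRingEnd ℂ) (d k) * (W k).eval (Complex.I * ω)).im := by
  by_contra! hcon
  -- Let t be the first time at which no edge line separates 0 strictly from the polygon.
  have hcont : ∀ k j, Continuous fun t : ℝ =>
      ((starRingEnd ℂ) (d j) * (W k).eval (Complex.I * t)).im := fun k j => by fun_prop
  obtain ⟨t, ⟨⟨ht0, htS⟩, htmin⟩⟩ : ∃ t, IsLeast {t : ℝ | t ∈ Set.Icc 0 ω ∧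
      ∀ k, ((starRingEnd ℂ) (d k) * (W k).eval (Complex.I * t)).im ≤ 0} t := by
    have hc : IsCompact {t : ℝ | t ∈ Set.Icc 0 ω ∧
        ∀ k, ((starRingEnd ℂ) (d k) * (W k).eval (Complex.I * t)).im ≤ 0} := by
      refine isCompact_Icc.inter_right (t := {t : ℝ | ∀ k,
        ((starRingEnd ℂ) (d k) * (W k).eval (Complex.I * t)).im ≤ 0}) ?_
      rw [Set.ofPred_forall]
      exact isClosed_iInter fun k => isClosed_le (hcont k k) continuous_const
    exact hc.exists_isLeast ⟨ω, ⟨hω, le_rfl⟩, hcon⟩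
  have htpos : 0 < t := by
    rcases ht0.1.eq_or_lt with h | h
    · obtain ⟨j, hj⟩ := h0
      have := htS j
      rw [← h] at this
      simp only [Complex.ofReal_zero, mul_zero] at this
      linarith [hj j]
    · exact h
  -- Otherwise 0 would be strictly inside and hence would already be inside slightly before t.
  obtain ⟨k, hk⟩ : ∃ k, ((starRingEnd ℂ) (d k) * (W k).eval (Complex.I * t)).im = 0 := by
    by_contra! hne
    have hev : ∀ᶠ x : ℝ in nhds t, ∀ k,
        ((starRingEnd ℂ) (d k) * (W k).eval (Complex.I * x)).im < 0 :=
      Filter.eventually_all.2 fun k =>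
        (hcont k k).continuousAt.eventually_lt continuousAt_const (lt_of_le_of_ne (htS k) (hne k))
    obtain ⟨ε, hε, hball⟩ := Metric.eventually_nhds_iff.1 hev
    have hx : max (t - ε / 2) 0 < t := max_lt (by linarith) htpos
    have hx' : dist (max (t - ε / 2) 0) t < ε := by
      rw [dist_comm, Real.dist_eq, abs_of_pos (by linarith)]
      linarith [le_max_left (t - ε / 2) 0]
    have := htmin (show max (t - ε / 2) 0 ∈ _ from
      ⟨⟨le_max_right _ _, hx.le.trans ht0.2⟩, fun k => (hball hx' k).le⟩)
    linarith
  have hP0 : (W k).eval (Complex.I * t) ≠ 0 := hW k _ (by simp)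
  have hQ0 : (W (k + 1)).eval (Complex.I * t) ≠ 0 := hW (k + 1) _ (by simp)
  have hkQ := (hedge k t).trans hk
  have hprev := htS (k - 1)
  rw [← hedge (k - 1) t, sub_add_cancel] at hprev
  have hnext := htS (k + 1)
  have hdprev := hd (k - 1)
  rw [sub_add_cancel] at hdprev
  have hdnext := hd k
  -- Both endpoints of the edge have the same component normal to the fixed direction `d k` at all
  -- times, so their normal velocities agree.
  have hderiv : ((starRingEnd ℂ) (d k) * (Complex.I * (W (k + 1)).derivative.eval (Complex.I * t))).im =
      ((starRingEnd ℂ) (d k) * (Complex.I * (W k).derivative.eval (Complex.I * t))).im := by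
    have hder : ∀ F : ℂ[X], HasDerivAt
        (fun x : ℝ => ((starRingEnd ℂ) (d k) * F.eval (Complex.I * x)).im)
        ((starRingEnd ℂ) (d k) * (Complex.I * F.derivative.eval (Complex.I * t))).im t := by
      intro F
      have h1 : HasDerivAt (fun x : ℝ => Complex.I * (x : ℂ)) Complex.I t := by
        simpa using (Complex.ofRealCLM.hasDerivAt (x := t)).const_mul Complex.I
      have h2 := ((F.hasDerivAt (Complex.I * t)).scomp t h1).const_mul ((starRingEnd ℂ) (d k))
      convert! Complex.imCLM.hasFDerivAt.comp_hasDerivAt t h2 using 1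
    have h1 := hder (W (k + 1))
    have h2 : (fun x : ℝ => ((starRingEnd ℂ) (d k) * (W (k + 1)).eval (Complex.I * x)).im) =
        fun x : ℝ => ((starRingEnd ℂ) (d k) * (W k).eval (Complex.I * x)).im :=
      funext (hedge k)
    rw [h2] at h1
    exact h1.unique (hder (W k))
  have hphP := im_derivative_mul_conj_nonneg_and_pos (hW k) t
  have hphQ := im_derivative_mul_conj_nonneg_and_pos (hW (k + 1)) t
  have hdk : d k ≠ 0 := by
    intro h
    rw [h] at hdnext
    simp at hdnext
  have hconst : (W k).natDegree = 0 → (W (k + 1)).natDegree = 0 → ∃ e : ℂ,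
      0 < ((starRingEnd ℂ) e * (W k).eval (Complex.I * t)).im ∧
      0 < ((starRingEnd ℂ) e * (W (k + 1)).eval (Complex.I * t)).im := by
    intro h1 h2
    obtain ⟨j, hj⟩ := h0
    refine ⟨d j, ?_, ?_⟩
    · have := hj k
      rw [eq_C_of_natDegree_eq_zero h1, eval_C] at this ⊢
      exact this
    · have := hj (k + 1)
      rw [eq_C_of_natDegree_eq_zero h2, eval_C] at this ⊢
      exact this
  generalize (W k).eval (Complex.I * t) = P at *
  generalize (W (k + 1)).eval (Complex.I * t) = Q at *
  generalize Complex.I * (W k).derivative.eval (Complex.I * t) = P' at *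
  generalize Complex.I * (W (k + 1)).derivative.eval (Complex.I * t) = Q' at *
  have hN : 0 < Complex.normSq (d k) := Complex.normSq_pos.2 hdk
  have colinear : ∀ Z : ℂ, ((starRingEnd ℂ) (d k) * Z).im = 0 →
      Complex.normSq (d k) * Z = ((starRingEnd ℂ) (d k) * Z).re * d k := by
    intro Z hZ
    have : ((((starRingEnd ℂ) (d k) * Z).re : ℝ) : ℂ) = (starRingEnd ℂ) (d k) * Z :=
      Complex.ext (by simp) (by simpa using hZ.symm)
    rw [this, ← Complex.mul_conj]
    ring
  have hPc := colinear P hk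
  have hQc := colinear Q hkQ
  set r := ((starRingEnd ℂ) (d k) * P).re
  set r' := ((starRingEnd ℂ) (d k) * Q).re
  have scale : ∀ Z : ℂ, ∀ x : ℝ, Complex.normSq (d k) * Z = x * d k → ∀ e : ℂ,
      Complex.normSq (d k) * (e * Z).im = x * (e * d k).im := by
    intro Z x hZ e
    have h1 : Complex.normSq (d k) * (e * Z) = x * (e * d k) := by
      rw [mul_left_comm, hZ]; ring
    have := congrArg Complex.im h1
    simpa only [Complex.im_ofReal_mul] using this
  have scale' : ∀ Z : ℂ, ∀ x : ℝ, Complex.normSq (d k) * Z = x * d k → ∀ e : ℂ,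
      Complex.normSq (d k) * (e * (starRingEnd ℂ) Z).im = x * ((starRingEnd ℂ) (d k) * e).im := by
    intro Z x hZ e
    have h1 : Complex.normSq (d k) * (e * (starRingEnd ℂ) Z) = x * ((starRingEnd ℂ) (d k) * e) := by
      have := congrArg (starRingEnd ℂ) hZ
      simp only [map_mul, Complex.conj_ofReal] at this
      rw [mul_left_comm, this]; ring
    have := congrArg Complex.im h1
    simpa only [Complex.im_ofReal_mul] using this
  have hr_ne : r ≠ 0 := by
    intro h
    rw [h] at hPc
    simp [hP0, hdk] at hPc
  have hr'_ne : r' ≠ 0 := by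
    intro h
    rw [h] at hQc
    simp [hQ0, hdk] at hQc
  -- The neighbouring edge lines place P behind 0 and Q ahead of 0 in direction `d k`.
  have hr : r < 0 := by
    refine lt_of_le_of_ne ?_ hr_ne
    have h1 := scale P r hPc ((starRingEnd ℂ) (d (k - 1)))
    by_contra! h
    nlinarith [mul_pos h hdprev, mul_nonneg hN.le (neg_nonneg.2 hprev)]
  have hr' : 0 < r' := by
    refine lt_of_le_of_ne ?_ hr'_ne.symm
    have h1 := scale Q r' hQc ((starRingEnd ℂ) (d (k + 1)))
    have h2 : ((starRingEnd ℂ) (d (k + 1)) * d k).im =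
        -((starRingEnd ℂ) (d k) * d (k + 1)).im := by
      simp only [Complex.mul_im, Complex.conj_re, Complex.conj_im]; ring
    rw [h2] at h1
    by_contra! h
    nlinarith [mul_pos (neg_pos.2 h) hdnext, mul_nonneg hN.le (neg_nonneg.2 hnext)]
  have hsP := scale' P r hPc P'
  have hsQ := scale' Q r' hQc Q'
  rw [hderiv] at hsQ
  set D := ((starRingEnd ℂ) (d k) * P').im
  -- Monotone phase gives r D ≥ 0 and r' D ≥ 0 with r < 0 < r', which forces D = 0; by strict phase
  -- growth both polynomials are then constant.
  have hD1 : D ≤ 0 := by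
    by_contra! h
    nlinarith [mul_nonneg hN.le hphP.1, mul_pos (neg_pos.2 hr) h]
  have hD2 : 0 ≤ D := by
    by_contra! h
    nlinarith [mul_nonneg hN.le hphQ.1, mul_pos hr' (neg_pos.2 h)]
  have hD : D = 0 := le_antisymm hD1 hD2
  rw [hD, mul_zero] at hsP hsQ
  have hdegP : (W k).natDegree = 0 := by
    by_contra h
    exact (mul_pos hN (hphP.2 h)).ne' hsP
  have hdegQ : (W (k + 1)).natDegree = 0 := by
    by_contra h
    exact (mul_pos hN (hphQ.2 h)).ne' hsQ
  -- Constant endpoints still lie strictly on one side of the initial separating line, so 0 cannot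
  -- lie between them.
  obtain ⟨e, he1, he2⟩ := hconst hdegP hdegQ
  have h1 := scale P r hPc ((starRingEnd ℂ) e)
  have h2 := scale Q r' hQc ((starRingEnd ℂ) e)
  rcases le_total 0 ((starRingEnd ℂ) e * d k).im with h | h
  · nlinarith [mul_pos hN he1, mul_nonneg (neg_nonneg.2 hr.le) h]
  · nlinarith [mul_pos hN he2, mul_nonneg hr'.le (neg_nonneg.2 h)]

/-! ### Moving rectangles and their sums -/

/-- The points `a 0 (iω), …, a 3 (iω)` are the corners, in counterclockwise order starting from the
lower left one, of an axis-parallel rectangle. -/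
structure IsMovingRectangle (a : Fin 4 → ℂ[X]) : Prop where
  left : ∀ ω : ℝ, ((a 3).eval (Complex.I * ω)).re = ((a 0).eval (Complex.I * ω)).re
  right : ∀ ω : ℝ, ((a 1).eval (Complex.I * ω)).re = ((a 2).eval (Complex.I * ω)).re
  bottom : ∀ ω : ℝ, ((a 1).eval (Complex.I * ω)).im = ((a 0).eval (Complex.I * ω)).im
  top : ∀ ω : ℝ, ((a 3).eval (Complex.I * ω)).im = ((a 2).eval (Complex.I * ω)).im

/-- The point `u` lies in the axis-parallel rectangle with lower left corner `a 0 (iω)` and upper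
right corner `a 2 (iω)`. -/
structure MemMovingRectangle (a : Fin 4 → ℂ[X]) (ω : ℝ) (u : ℂ) : Prop where
  re_ge : ((a 0).eval (Complex.I * ω)).re ≤ u.re
  re_le : u.re ≤ ((a 2).eval (Complex.I * ω)).re
  im_ge : ((a 0).eval (Complex.I * ω)).im ≤ u.im
  im_le : u.im ≤ ((a 2).eval (Complex.I * ω)).im

/-- The rectangle turned by a right angle. -/
noncomputable def rotateCorners (a : Fin 4 → ℂ[X]) : Fin 4 → ℂ[X] := fun k => C Complex.I * a (k - 1)

/-- The index shift in `rotateCorners` keeps the counterclockwise numbering: multiplication by i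
sends the upper left corner to the lower left one. -/
theorem IsMovingRectangle.rotate {a : Fin 4 → ℂ[X]} (ha : IsMovingRectangle a) :
    IsMovingRectangle (rotateCorners a) where
  left ω := by simpa [rotateCorners, show (-1 : Fin 4) = 3 from rfl] using (ha.top ω).symm
  right ω := by simpa [rotateCorners, show (-1 : Fin 4) = 3 from rfl] using (ha.bottom ω).symm
  bottom ω := by simpa [rotateCorners, show (-1 : Fin 4) = 3 from rfl] using (ha.left ω).symm
  top ω := by simpa [rotateCorners, show (-1 : Fin 4) = 3 from rfl] using (ha.right ω).symm

theorem MemMovingRectangle.rotate {a : Fin 4 → ℂ[X]} (ha : IsMovingRectangle a) {ω : ℝ} {u : ℂ}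
    (hu : MemMovingRectangle a ω u) :
    MemMovingRectangle (rotateCorners a) ω (Complex.I * u) where
  re_ge := by simpa [rotateCorners, show (-1 : Fin 4) = 3 from rfl, ha.top] using hu.im_le
  re_le := by simpa [rotateCorners, show (-1 : Fin 4) = 3 from rfl, ha.bottom] using hu.im_ge
  im_ge := by simpa [rotateCorners, show (-1 : Fin 4) = 3 from rfl, ha.left] using hu.re_ge
  im_le := by simpa [rotateCorners, show (-1 : Fin 4) = 3 from rfl, ha.right] using hu.re_le

theorem IsMovingRectangle.iterate_rotate {b : Fin 4 → ℂ[X]} (hb : IsMovingRectangle b) :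
    ∀ n : ℕ, IsMovingRectangle (rotateCorners^[n] b)
  | 0 => hb
  | n + 1 => by rw [Function.iterate_succ_apply']; exact (hb.iterate_rotate n).rotate

theorem MemMovingRectangle.iterate_rotate {b : Fin 4 → ℂ[X]} (hb : IsMovingRectangle b) {ω : ℝ}
    {v : ℂ} (hv : MemMovingRectangle b ω v) :
    ∀ n : ℕ, MemMovingRectangle (rotateCorners^[n] b) ω (Complex.I ^ n * v)
  | 0 => by simpa using hv
  | n + 1 => by
    rw [Function.iterate_succ_apply', pow_succ', mul_assoc]
    exact (hv.iterate_rotate hb n).rotate (hb.iterate_rotate n)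

theorem iterate_rotateCorners_apply (b : Fin 4 → ℂ[X]) (n k : Fin 4) :
    rotateCorners^[(n : ℕ)] b k = C (Complex.I ^ (n : ℕ)) * b (k - n) := by
  fin_cases n <;> simp [rotateCorners, pow_succ, sub_sub, ← mul_assoc, ← C_mul]

theorem IsMovingRectangle.add_real_mul {a b : Fin 4 → ℂ[X]} (ha : IsMovingRectangle a)
    (hb : IsMovingRectangle b) (x : ℝ) :
    IsMovingRectangle fun k => a k + C (x : ℂ) * b k where
  left ω := by simp [ha.left, hb.left]
  right ω := by simp [ha.right, hb.right]
  bottom ω := by simp [ha.bottom, hb.bottom]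
  top ω := by simp [ha.top, hb.top]

theorem MemMovingRectangle.add_real_mul {a b : Fin 4 → ℂ[X]} {ω : ℝ} {u v : ℂ}
    (hu : MemMovingRectangle a ω u) (hv : MemMovingRectangle b ω v) {x : ℝ} (hx : 0 ≤ x) :
    MemMovingRectangle (fun k => a k + C (x : ℂ) * b k) ω (u + x * v) where
  re_ge := by simpa using add_le_add hu.re_ge (mul_le_mul_of_nonneg_left hv.re_ge hx)
  re_le := by simpa using add_le_add hu.re_le (mul_le_mul_of_nonneg_left hv.re_le hx)
  im_ge := by simpa using add_le_add hu.im_ge (mul_le_mul_of_nonneg_left hv.im_ge hx)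
  im_le := by simpa using add_le_add hu.im_le (mul_le_mul_of_nonneg_left hv.im_le hx)

theorem IsMovingRectangle.ne_zero_of_mem {a : Fin 4 → ℂ[X]} (ha : IsMovingRectangle a)
    (hW : ∀ k (s : ℂ), 0 ≤ s.re → (a k).eval s ≠ 0)
    (h0 : ∃ m : Fin 4, ∀ k,
      0 < ((starRingEnd ℂ) (Complex.I ^ (m : ℕ)) * (a k).eval 0).im)
    {ω : ℝ} (hω : 0 ≤ ω) {u : ℂ} (hu : MemMovingRectangle a ω u) : u ≠ 0 := by
  rintro rfl
  obtain ⟨k, hk⟩ := exists_separating_edge (fun m : Fin 4 => Complex.I ^ (m : ℕ)) a hW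
    (by intro k; fin_cases k <;> simp [pow_succ])
    (by
      intro k ω
      have h1 := ha.left ω
      have h2 := ha.right ω
      have h3 := ha.bottom ω
      have h4 := ha.top ω
      fin_cases k <;> simp [pow_succ] <;> linarith) h0 hω
  obtain ⟨u1, u2, u3, u4⟩ := hu
  have h1 := ha.left ω
  have h2 := ha.right ω
  have h3 := ha.bottom ω
  have h4 := ha.top ω
  simp only [Complex.zero_re, Complex.zero_im] at u1 u2 u3 u4
  fin_cases k <;> simp [pow_succ] at hk <;> linarith

/-- For z in the open first quadrant, the edges of both rectangles sorted by angle have directions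
1, z, i, iz, -1, -z, -i, -iz. Traversing them from a 0 + z b 0 advances the corners of a and b
alternately, so only the eight listed sums are vertices. -/
theorem IsMovingRectangle.add_mul_ne_zero_of_mem {a b : Fin 4 → ℂ[X]} (ha : IsMovingRectangle a)
    (hb : IsMovingRectangle b) {z : ℂ} (hre : 0 < z.re) (him : 0 < z.im)
    (hW : ∀ k (s : ℂ), 0 ≤ s.re → (a k + C z * b k).eval s ≠ 0)
    (hW' : ∀ k (s : ℂ), 0 ≤ s.re → (a (k + 1) + C z * b k).eval s ≠ 0)
    (h0 : ∃ m : Fin 4, ∀ k,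
      0 < ((starRingEnd ℂ) (Complex.I ^ (m : ℕ)) * (a k + C z * b k).eval 0).im ∧
      0 < ((starRingEnd ℂ) (Complex.I ^ (m : ℕ)) * (a (k + 1) + C z * b k).eval 0).im)
    {ω : ℝ} (hω : 0 ≤ ω) {u v : ℂ} (hu : MemMovingRectangle a ω u)
    (hv : MemMovingRectangle b ω v) : u + z * v ≠ 0 := by
  intro huv
  set d : Fin 8 → ℂ := ![1, z, Complex.I, Complex.I * z, -1, -z, -Complex.I, -(Complex.I * z)]
    with hd
  set W : Fin 8 → ℂ[X] := ![a 0 + C z * b 0, a 1 + C z * b 0, a 1 + C z * b 1, a 2 + C z * b 1,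
    a 2 + C z * b 2, a 3 + C z * b 2, a 3 + C z * b 3, a 0 + C z * b 3] with hWdef
  have hall : ∀ p : ℂ[X] → Prop, (∀ k, p (a k + C z * b k)) →
      (∀ k, p (a (k + 1) + C z * b k)) → ∀ k, p (W k) := by
    intro p h1 h2 k
    fin_cases k
    exacts [h1 0, h2 0, h1 1, h2 1, h1 2, h2 2, h1 3, h2 3]
  obtain ⟨m, hm⟩ := h0
  have hstart : ∃ j, ∀ k, 0 < ((starRingEnd ℂ) (d j) * (W k).eval 0).im := by
    have hdm : ∃ j, d j = Complex.I ^ (m : ℕ) := by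
      fin_cases m
      exacts [⟨0, by simp [hd]⟩, ⟨2, by simp [hd]⟩, ⟨4, by simp [hd]⟩, ⟨6, by simp [hd, pow_succ]⟩]
    obtain ⟨j, hj⟩ := hdm
    refine ⟨j, hall (fun F => 0 < ((starRingEnd ℂ) (d j) * F.eval 0).im) ?_ ?_⟩ <;>
    · intro k
      simp only [hj]
      first | exact (hm k).1 | exact (hm k).2
  have a1 := ha.left
  have a2 := ha.right
  have a3 := ha.bottom
  have a4 := ha.top
  have b1 := hb.left
  have b2 := hb.right
  have b3 := hb.bottom
  have b4 := hb.top
  obtain ⟨k, hk⟩ := exists_separating_edge d W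
    (hall (fun F => ∀ s : ℂ, 0 ≤ s.re → F.eval s ≠ 0) hW hW')
    (by intro k; fin_cases k <;> simp [hd] <;> nlinarith)
    (by
      intro k ω
      fin_cases k <;> simp [hd, hWdef, a1, a2, a3, a4, b1, b2, b3, b4] <;> ring)
    hstart hω
  have hure := congrArg Complex.re huv
  have huim := congrArg Complex.im huv
  simp only [Complex.add_re, Complex.add_im, Complex.mul_re, Complex.mul_im, Complex.zero_re,
    Complex.zero_im] at hure huim
  obtain ⟨u1, u2, u3, u4⟩ := hu
  obtain ⟨v1, v2, v3, v4⟩ := hv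
  -- The separating inequality is linear in the corner coordinates with coefficients 1, Re z, Im z
  -- and |z|²; the products below let `linarith` refute it.
  have hn : 0 < z.re ^ 2 + z.im ^ 2 := by positivity
  have c1 := congrArg (z.re * ·) hure
  have c2 := congrArg (z.im * ·) hure
  have c3 := congrArg (z.re * ·) huim
  have c4 := congrArg (z.im * ·) huim
  have p := fun {x y : ℝ} (h : x ≤ y) => mul_le_mul_of_nonneg_left h hre.le
  have q := fun {x y : ℝ} (h : x ≤ y) => mul_le_mul_of_nonneg_left h him.le
  have r := fun {x y : ℝ} (h : x ≤ y) => mul_le_mul_of_nonneg_left h hn.le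
  have p1 := p u1
  have p2 := p u2
  have p3 := p u3
  have p4 := p u4
  have p5 := p v1
  have p6 := p v2
  have p7 := p v3
  have p8 := p v4
  have q1 := q u1
  have q2 := q u2
  have q3 := q u3
  have q4 := q u4
  have q5 := q v1
  have q6 := q v2
  have q7 := q v3
  have q8 := q v4
  have r1 := r v1
  have r2 := r v2
  have r3 := r v3
  have r4 := r v4
  fin_cases k <;> simp [hd, hWdef, a1, a2, a3, a4, b1, b2, b3, b4] at hk <;> linarith

/-- Zero exclusion for the sum of a rectangle and a multiple, by a non-zero complex number, of a
second rectangle. -/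
theorem IsMovingRectangle.add_I_pow_mul_ne_zero_of_mem {a b : Fin 4 → ℂ[X]}
    (ha : IsMovingRectangle a) (hb : IsMovingRectangle b) {z w : ℂ} (n : Fin 4)
    (hzw : z = Complex.I ^ (n : ℕ) * w) (hre : 0 < w.re) (him : 0 ≤ w.im)
    (p : ℂ[X] → Prop) (hp : ∀ F, p F → ∀ s : ℂ, 0 ≤ s.re → F.eval s ≠ 0)
    (h0 : ∃ m : Fin 4, ∀ F, p F → 0 < ((starRingEnd ℂ) (Complex.I ^ (m : ℕ)) * F.eval 0).im)
    (hW : ∀ k, p (a k + C z * b (k - n)))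
    (hW' : 0 < w.im → ∀ k, p (a (k + 1) + C z * b (k - n)))
    {ω : ℝ} (hω : 0 ≤ ω) {u v : ℂ} (hu : MemMovingRectangle a ω u)
    (hv : MemMovingRectangle b ω v) : u + z * v ≠ 0 := by
  obtain ⟨m, hm⟩ := h0
  have hbr := hb.iterate_rotate (n : ℕ)
  have hvr := hv.iterate_rotate hb (n : ℕ)
  have hmul : ∀ k, C z * b (k - n) = C w * rotateCorners^[(n : ℕ)] b k := by
    intro k
    rw [iterate_rotateCorners_apply, hzw, C_mul]
    ring
  have hval : z * v = w * (Complex.I ^ (n : ℕ) * v) := by rw [hzw]; ring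
  simp only [hmul] at hW hW'
  rw [hval]
  -- For real w the two rectangles are parallel, so their sum is a rectangle and the vertices of
  -- `hW` suffice.
  rcases him.eq_or_lt with h | h
  · obtain ⟨x, rfl⟩ : ∃ x : ℝ, w = x := ⟨w.re, Complex.ext (by simp) (by simp [← h])⟩
    exact (ha.add_real_mul hbr x).ne_zero_of_mem (fun k => hp _ (hW k))
      ⟨m, fun k => hm _ (hW k)⟩ hω (hu.add_real_mul hvr (le_of_lt (by simpa using hre)))
  · exact ha.add_mul_ne_zero_of_mem hbr hre h (fun k => hp _ (hW k)) (fun k => hp _ (hW' h k))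
      ⟨m, fun k => ⟨hm _ (hW k), hm _ (hW' h k)⟩⟩ hω hu hvr

/-! ### Root-free half planes along a segment of polynomials -/

theorem pow_card_le_norm_prod_sub {s : ℂ} (hs : 0 ≤ s.re) (m : Multiset ℂ)
    (hm : ∀ z ∈ m, z.re < 0) : s.re ^ Multiset.card m ≤ ‖(m.map (s - ·)).prod‖ := by
  induction m using Multiset.induction_on with
  | empty => simp
  | cons z m ih =>
    rw [Multiset.card_cons, Multiset.map_cons, Multiset.prod_cons, norm_mul, pow_succ']
    refine mul_le_mul ?_ (ih fun w hw => hm w (Multiset.mem_cons_of_mem hw)) (by positivity)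
      (norm_nonneg _)
    have h1 := hm z (Multiset.mem_cons_self z m)
    have h2 := Complex.re_le_norm (s - z)
    rw [Complex.sub_re] at h2
    linarith

/-- A polynomial without roots in the closed right half plane is bounded below there. -/
theorem leadingCoeff_mul_re_pow_le_norm_eval {F : ℂ[X]}
    (hF : ∀ s : ℂ, 0 ≤ s.re → F.eval s ≠ 0) {s : ℂ} (hs : 0 ≤ s.re) :
    ‖F.leadingCoeff‖ * s.re ^ F.natDegree ≤ ‖F.eval s‖ := by
  rw [(IsAlgClosed.splits F).eval_eq_prod_roots, norm_mul,
    (IsAlgClosed.splits F).natDegree_eq_card_roots]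
  refine mul_le_mul_of_nonneg_left (pow_card_le_norm_prod_sub hs _ fun z hz => ?_) (norm_nonneg _)
  by_contra! h
  exact hF z h (Polynomial.isRoot_of_mem_roots hz)

/-- Along a segment of complex polynomials of constant degree without roots on the imaginary axis,
the absence of roots in the closed right half plane is preserved. -/
theorem eval_ne_zero_of_segment {P Q : ℂ[X]} {n : ℕ} (hPn : P.natDegree ≤ n)
    (hQn : Q.natDegree ≤ n)
    (hlead : ∀ t ∈ Set.Icc (0 : ℝ) 1, (1 - t : ℂ) * P.coeff n + t * Q.coeff n ≠ 0)
    (haxis : ∀ t ∈ Set.Icc (0 : ℝ) 1, ∀ s : ℂ, s.re = 0 → (1 - t : ℂ) * P.eval s + t * Q.eval s ≠ 0)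
    (hP : ∀ s : ℂ, 0 ≤ s.re → P.eval s ≠ 0) {s : ℂ} (hs : 0 ≤ s.re) : Q.eval s ≠ 0 := by
  set F : unitInterval → ℂ[X] := fun t => C (1 - (t : ℝ) : ℂ) * P + C ((t : ℝ) : ℂ) * Q with hF
  have heval : ∀ t s, (F t).eval s = (1 - (t : ℝ) : ℂ) * P.eval s + (t : ℝ) * Q.eval s := by
    intro t s
    simp [hF]
  have hcoeff : ∀ t i, (F t).coeff i = (1 - (t : ℝ) : ℂ) * P.coeff i + (t : ℝ) * Q.coeff i := by
    intro t i
    simp only [hF, coeff_add, coeff_C_mul]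
  have hn0 : ∀ t, (F t).coeff n ≠ 0 := fun t => by rw [hcoeff]; exact hlead t t.2
  have hdeg : ∀ t, (F t).natDegree = n := by
    intro t
    refine natDegree_eq_of_le_of_coeff_ne_zero ?_ (hn0 t)
    refine (natDegree_add_le _ _).trans (max_le ?_ ?_)
    · exact (natDegree_C_mul_le _ _).trans hPn
    · exact (natDegree_C_mul_le _ _).trans hQn
  have hlc : ∀ t, (F t).leadingCoeff = (F t).coeff n := fun t => by rw [leadingCoeff, hdeg]
  have hcont : Continuous fun x : unitInterval × ℂ => (F x.1).eval x.2 := by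
    simp only [heval]
    fun_prop
  have hcontc : Continuous fun t : unitInterval => (F t).coeff n := by
    simp only [hcoeff]
    fun_prop
  -- The lower bound ‖lc‖ (Re s)^n ≤ ‖F(s)‖ is a closed condition on t that rules out roots with Re
  -- s > 0; `haxis` rules out those on the axis.
  have hclosed : IsClosed {t | ∀ s : ℂ, 0 ≤ s.re → (F t).eval s ≠ 0} := by
    have : {t | ∀ s : ℂ, 0 ≤ s.re → (F t).eval s ≠ 0} =
        ⋂ s ∈ {s : ℂ | 0 ≤ s.re}, {t | ‖(F t).coeff n‖ * s.re ^ n ≤ ‖(F t).eval s‖} := by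
      ext t
      simp only [Set.mem_iInter]
      constructor
      · intro h s hs
        have := leadingCoeff_mul_re_pow_le_norm_eval h hs
        rwa [hlc, hdeg] at this
      · intro h s hs h0
        rcases hs.eq_or_lt with h1 | h1
        · exact haxis t t.2 s h1.symm (by rw [← heval, h0])
        · have h2 : ‖(F t).coeff n‖ * s.re ^ n ≤ ‖(F t).eval s‖ := h s hs
          rw [h0, norm_zero] at h2
          have := mul_pos (norm_pos_iff.2 (hn0 t)) (pow_pos h1 n)
          linarith
    rw [this]
    refine isClosed_biInter fun s _ => isClosed_le (hcontc.norm.mul continuous_const) ?_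
    exact (hcont.comp (Continuous.prodMk_left s)).norm
  obtain ⟨R, hR⟩ : ∃ R : ℝ, ∀ t s, (F t).eval s = 0 → ‖s‖ ≤ R := by
    set M : ℝ := ∑ i ∈ Finset.range n, (‖P.coeff i‖ + ‖Q.coeff i‖) with hM
    have hMc : ∀ t, ∀ i < n, ‖(F t).coeff i‖ ≤ M := by
      intro t i hi
      have h1 : ‖(F t).coeff i‖ ≤ ‖P.coeff i‖ + ‖Q.coeff i‖ := by
        rw [hcoeff]
        refine (norm_add_le _ _).trans (add_le_add ?_ ?_)
        · rw [norm_mul]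
          refine mul_le_of_le_one_left (norm_nonneg _) ?_
          rw [← Complex.ofReal_one, ← Complex.ofReal_sub, Complex.norm_real, Real.norm_eq_abs,
            abs_of_nonneg (by linarith [t.2.2])]
          linarith [t.2.1]
        · rw [norm_mul]
          refine mul_le_of_le_one_left (norm_nonneg _) ?_
          rw [Complex.norm_real, Real.norm_eq_abs, abs_of_nonneg t.2.1]
          exact t.2.2
      exact h1.trans (Finset.single_le_sum
        (f := fun i => ‖P.coeff i‖ + ‖Q.coeff i‖) (fun i _ => by positivity) (Finset.mem_range.2 hi))
    have hM0 : 0 ≤ M := Finset.sum_nonneg fun i _ => by positivity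
    have hc : Continuous fun t : unitInterval => M / ‖(F t).coeff n‖ + 1 :=
      (continuous_const.div hcontc.norm fun t => norm_ne_zero_iff.2 (hn0 t)).add continuous_const
    obtain ⟨R, hR⟩ := (isCompact_univ.image hc).bddAbove
    refine ⟨R, fun t s hts => le_trans ?_ (hR ⟨t, Set.mem_univ t, rfl⟩)⟩
    have hFt : F t ≠ 0 := fun h => hn0 t (by rw [h, coeff_zero])
    have h1 := (IsRoot.norm_lt_cauchyBound hFt hts).le
    rw [cauchyBound, hdeg, hlc] at h1
    have h2 : ‖s‖ ≤ ((Finset.range n).sup (‖(F t).coeff ·‖₊) : NNReal) / ‖(F t).coeff n‖ + 1 := by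
      exact_mod_cast h1
    have h3 : (Finset.range n).sup (‖(F t).coeff ·‖₊) ≤ (⟨M, hM0⟩ : NNReal) :=
      Finset.sup_le fun i hi => hMc t i (Finset.mem_range.1 hi)
    have h4 : (((Finset.range n).sup (‖(F t).coeff ·‖₊) : NNReal) : ℝ) ≤ M := h3
    exact h2.trans (add_le_add_left (div_le_div_of_nonneg_right h4 (norm_nonneg _)) 1)
  -- By the uniform Cauchy bound R, the complement is the projection of a compact set of pairs (t,
  -- root).
  have hopen : IsOpen {t | ∀ s : ℂ, 0 ≤ s.re → (F t).eval s ≠ 0} := by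
    rw [← isClosed_compl_iff]
    have : {t | ∀ s : ℂ, 0 ≤ s.re → (F t).eval s ≠ 0}ᶜ = Prod.fst ''
        ((Set.univ ×ˢ (Metric.closedBall (0 : ℂ) R ∩ {s | 0 ≤ s.re})) ∩
          {x : unitInterval × ℂ | (F x.1).eval x.2 = 0}) := by
      ext t
      constructor
      · intro h
        have h' : ¬ ∀ s : ℂ, 0 ≤ s.re → (F t).eval s ≠ 0 := h
        push Not at h'
        obtain ⟨s, hs, h0⟩ := h'
        exact ⟨(t, s), ⟨⟨Set.mem_univ t, by simpa using hR t s h0, hs⟩, h0⟩, rfl⟩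
      · rintro ⟨⟨t, s⟩, ⟨⟨-, -, hs⟩, h0⟩, rfl⟩ h
        exact h s hs h0
    rw [this]
    refine IsCompact.isClosed (IsCompact.image ?_ continuous_fst)
    refine IsCompact.inter_right ?_ (isClosed_eq hcont continuous_const)
    exact isCompact_univ.prod ((isCompact_closedBall 0 R).inter_right
      (isClosed_le continuous_const Complex.continuous_re))
  have huniv := IsClopen.eq_univ ⟨hclosed, hopen⟩ ⟨0, fun s hs => by
    rw [heval]
    simpa using hP s hs⟩
  have h1 : (1 : unitInterval) ∈ {t | ∀ s : ℂ, 0 ≤ s.re → (F t).eval s ≠ 0} :=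
    huniv ▸ Set.mem_univ _
  have := h1 s hs
  rw [heval] at this
  simpa using this

/-! ### Hurwitz and strictly positive real polynomials -/

/-- A Hurwitz stable polynomial with positive leading coefficient is positive at `0`. -/
theorem IsHurwitz.eval_zero_pos {p : ℝ[X]} (hp : IsHurwitz p) (hlc : 0 < p.leadingCoeff) :
    0 < p.eval 0 := by
  by_contra! h
  obtain ⟨x, hx, hx0⟩ : ∃ x : ℝ, 0 ≤ x ∧ p.eval x = 0 := by
    have hdeg : 0 < p.degree := by
      by_contra! hd
      rw [eq_C_of_degree_le_zero hd] at h hlc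
      simp at h hlc
      linarith
    have ht := tendsto_atTop_of_leadingCoeff_nonneg p hdeg hlc.le
    obtain ⟨y, hy, hy0⟩ := ((ht.eventually_ge_atTop 0).and (Filter.eventually_ge_atTop 0)).exists
    obtain ⟨x, hx, hx0⟩ := intermediate_value_Icc hy0 p.continuous.continuousOn ⟨h, hy⟩
    exact ⟨x, hx.1, hx0⟩
  have h1 := hp (x : ℂ) (by
    have := aeval_algebraMap_apply ℂ x p
    simp only [Complex.coe_algebraMap] at this
    rw [this, coe_aeval_eq_eval, hx0, Complex.ofReal_zero])
  rw [Complex.ofReal_re] at h1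
  linarith

theorem IsHurwitz.neg {p : ℝ[X]} (hp : IsHurwitz p) : IsHurwitz (-p) := by
  intro s hs
  exact hp s (by simpa using hs)

/-- At a strictly positive real transfer function with shift `γ`, the polynomials `p + z q` with
`z.re = γ` have no roots in the closed right half plane. -/
theorem IsShiftedSPR.eval_add_mul_ne_zero {γ : ℝ} {p q : ℝ[X]} (h : IsShiftedSPR γ p q) {z : ℂ}
    (hz : z.re = γ) {s : ℂ} (hs : 0 ≤ s.re) :
    (p.map (algebraMap ℝ ℂ) + C z * q.map (algebraMap ℝ ℂ)).eval s ≠ 0 := by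
  obtain ⟨hdeg, hq, hpos⟩ := h
  have hq' : ∀ s : ℂ, 0 ≤ s.re → (q.map (algebraMap ℝ ℂ)).eval s ≠ 0 := by
    intro s hs h0
    rw [eval_map_algebraMap] at h0
    exact absurd (hq s h0) (not_lt.2 hs)
  have hq0 : q ≠ 0 := by
    rintro rfl
    simpa using hq' 0 (by simp)
  have hdeg' : ((C γ * q + p).map (algebraMap ℝ ℂ)).degree ≤ (q.map (algebraMap ℝ ℂ)).degree := by
    rw [degree_map, degree_map, degree_eq_natDegree hq0]
    exact degree_le_of_natDegree_le hdeg
  have key := re_div_pos_of_re_div_pos_on_imaginary_axis hdeg' hq'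
    (by simpa only [eval_map_algebraMap] using hpos) hs
  intro h0
  have hz' : z = γ + Complex.I * z.im := by
    rw [← hz, mul_comm]; exact (Complex.re_add_im z).symm
  -- A root s would make (γ q + p)/q equal to -i Im z at s, with real part 0.
  have h1 : ((C γ * q + p).map (algebraMap ℝ ℂ)).eval s =
      -(Complex.I * z.im) * (q.map (algebraMap ℝ ℂ)).eval s := by
    rw [hz'] at h0
    simp only [eval_add, eval_mul, eval_C, Polynomial.map_add, Polynomial.map_mul, map_C,
      Complex.coe_algebraMap] at h0 ⊢
    linear_combination h0
  rw [h1, mul_div_cancel_right₀ _ (hq' s hs)] at key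
  simp at key

/-! ### Value sets of interval families -/

theorem aeval_polyOfCoeffs (n : ℕ) (q : ℕ → ℝ) (s : ℂ) :
    aeval s (polyOfCoeffs n q) = ∑ i ∈ Finset.range (n + 1), (q i : ℂ) * s ^ i := by
  simp [polyOfCoeffs]

theorem re_aeval_polyOfCoeffs (n : ℕ) (q : ℕ → ℝ) (ω : ℝ) :
    (aeval (Complex.I * ω) (polyOfCoeffs n q)).re =
      ∑ i ∈ Finset.range (n + 1), q i * (ω ^ i * (Complex.I ^ (i % 4)).re) := by
  rw [aeval_polyOfCoeffs, Complex.re_sum]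
  refine Finset.sum_congr rfl fun i _ => ?_
  rw [Complex.re_ofReal_mul, mul_pow, mul_comm (_ ^ _), ← Complex.ofReal_pow,
    Complex.re_ofReal_mul, Complex.I_pow_eq_pow_mod]

theorem im_aeval_polyOfCoeffs (n : ℕ) (q : ℕ → ℝ) (ω : ℝ) :
    (aeval (Complex.I * ω) (polyOfCoeffs n q)).im =
      ∑ i ∈ Finset.range (n + 1), q i * (ω ^ i * (Complex.I ^ (i % 4)).im) := by
  rw [aeval_polyOfCoeffs, Complex.im_sum]
  refine Finset.sum_congr rfl fun i _ => ?_
  rw [Complex.im_ofReal_mul, mul_pow, mul_comm (_ ^ _), ← Complex.ofReal_pow,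
    Complex.im_ofReal_mul, Complex.I_pow_eq_pow_mod]

theorem coeff_polyOfCoeffs {n i : ℕ} (q : ℕ → ℝ) (hi : i ≤ n) : (polyOfCoeffs n q).coeff i = q i := by
  simp [polyOfCoeffs, coeff_C_mul, coeff_X_pow, hi]

theorem natDegree_polyOfCoeffs_le (n : ℕ) (q : ℕ → ℝ) : (polyOfCoeffs n q).natDegree ≤ n :=
  natDegree_sum_le_of_forall_le _ _ fun _ hi =>
    (natDegree_C_mul_X_pow_le _ _).trans (Nat.lt_succ_iff.1 (Finset.mem_range.1 hi))

namespace RealIntervalFamily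

/-- The Kharitonov polynomials, in the order in which their values at `iω` run counterclockwise
through the corners of the value set. -/
noncomputable def corners (Γ : RealIntervalFamily) : Fin 4 → ℝ[X] := ![Γ.K₁, Γ.K₃, Γ.K₂, Γ.K₄]

theorem corners_mem (Γ : RealIntervalFamily) (k : Fin 4) : Γ.corners k ∈ Γ.polys := by
  fin_cases k
  all_goals
    refine ⟨_, fun i hi => ?_, rfl⟩
    have := Γ.lower_le_upper i hi
    split_ifs <;> constructor <;> linarith

theorem natDegree_le {Γ : RealIntervalFamily} {p : ℝ[X]} (hp : p ∈ Γ.polys) :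
    p.natDegree ≤ Γ.order := by
  obtain ⟨q, -, rfl⟩ := hp
  exact natDegree_polyOfCoeffs_le _ _

theorem coeff_order_mem {Γ : RealIntervalFamily} {p : ℝ[X]} (hp : p ∈ Γ.polys) :
    p.coeff Γ.order ∈ Set.Icc (Γ.lower Γ.order) (Γ.upper Γ.order) := by
  obtain ⟨q, hq, rfl⟩ := hp
  rw [coeff_polyOfCoeffs q le_rfl]
  exact hq _ le_rfl

theorem natDegree_eq {Γ : RealIntervalFamily}
    (h : (0 : ℝ) ∉ Set.Icc (Γ.lower Γ.order) (Γ.upper Γ.order)) {p : ℝ[X]} (hp : p ∈ Γ.polys) :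
    p.natDegree = Γ.order :=
  natDegree_eq_of_le_of_coeff_ne_zero (natDegree_le hp) fun h0 => h (h0 ▸ coeff_order_mem hp)

theorem convex_combination_mem {Γ : RealIntervalFamily} {p q : ℝ[X]} (hp : p ∈ Γ.polys)
    (hq : q ∈ Γ.polys) {t : ℝ} (ht : t ∈ Set.Icc (0 : ℝ) 1) :
    C (1 - t) * p + C t * q ∈ Γ.polys := by
  obtain ⟨a, ha, rfl⟩ := hp
  obtain ⟨b, hb, rfl⟩ := hq
  refine ⟨fun i => (1 - t) * a i + t * b i, fun i hi => ?_, ?_⟩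
  · exact (convex_Icc _ _) (ha i hi) (hb i hi) (sub_nonneg.2 ht.2) ht.1 (by ring)
  · simp only [polyOfCoeffs, Finset.mul_sum, ← Finset.sum_add_distrib]
    refine Finset.sum_congr rfl fun i _ => ?_
    simp only [C_add, C_mul]
    ring

theorem isMovingRectangle_corners (Γ : RealIntervalFamily) :
    IsMovingRectangle fun k => (Γ.corners k).map (algebraMap ℝ ℂ) := by
  constructor
  all_goals
    intro ω
    simp only [eval_map_algebraMap, corners, Matrix.cons_val, K₁, K₂, K₃, K₄,
      re_aeval_polyOfCoeffs, im_aeval_polyOfCoeffs]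
    refine Finset.sum_congr rfl fun i _ => ?_
    have hi : i % 4 < 4 := Nat.mod_lt _ (by norm_num)
    interval_cases i % 4 <;> simp [pow_succ]

/-- Since i^k has period four, the Kharitonov sign patterns minimise or maximise the real and
imaginary parts term by term. This needs ω ≥ 0, as odd powers of a negative ω would reverse the
inequalities. -/
theorem memMovingRectangle_corners {Γ : RealIntervalFamily} {p : ℝ[X]} (hp : p ∈ Γ.polys) {ω : ℝ}
    (hω : 0 ≤ ω) :
    MemMovingRectangle (fun k => (Γ.corners k).map (algebraMap ℝ ℂ)) ω
      (aeval (Complex.I * ω) p) := by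
  obtain ⟨q, hq, rfl⟩ := hp
  constructor
  all_goals
    simp only [eval_map_algebraMap, corners, Matrix.cons_val, K₁, K₂,
      re_aeval_polyOfCoeffs, im_aeval_polyOfCoeffs]
    refine Finset.sum_le_sum fun i hmem => ?_
    obtain ⟨h1, h2⟩ := hq i (Nat.lt_succ_iff.1 (Finset.mem_range.1 hmem))
    have h3 := mul_le_mul_of_nonneg_right h1 (pow_nonneg hω i)
    have h4 := mul_le_mul_of_nonneg_right h2 (pow_nonneg hω i)
    have hi : i % 4 < 4 := Nat.mod_lt _ (by norm_num)
    interval_cases i % 4 <;> simp [pow_succ] <;> assumption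

end RealIntervalFamily

/-! ### Kharitonov's theorem -/

theorem aeval_I_mul_neg (p : ℝ[X]) (ω : ℝ) :
    aeval (Complex.I * (-ω : ℝ)) p = (starRingEnd ℂ) (aeval (Complex.I * ω) p) := by
  rw [← aeval_conj]
  simp

namespace RealIntervalFamily

/-- If the Kharitonov polynomials of a family of fixed order are Hurwitz stable, then their values
at `0` are non-zero and have a common sign. -/
theorem eval_zero_corners_sign {Γ : RealIntervalFamily}
    (horder : (0 : ℝ) ∉ Set.Icc (Γ.lower Γ.order) (Γ.upper Γ.order))
    (hK : ∀ k, IsHurwitz (Γ.corners k)) :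
    (∀ k, 0 < (Γ.corners k).eval 0) ∨ ∀ k, (Γ.corners k).eval 0 < 0 := by
  have hmem := fun k => coeff_order_mem (Γ.corners_mem k)
  have hlc : ∀ k, (Γ.corners k).leadingCoeff = (Γ.corners k).coeff Γ.order := fun k => by
    rw [leadingCoeff, natDegree_eq horder (Γ.corners_mem k)]
  rw [Set.mem_Icc, not_and_or, not_le, not_le] at horder
  refine horder.imp (fun h k => ?_) fun h k => ?_
  · exact (hK k).eval_zero_pos (by rw [hlc]; exact h.trans_le (hmem k).1)
  · have := (hK k).neg.eval_zero_pos
      (by rw [leadingCoeff_neg, hlc]; linarith [(hmem k).2])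
    rw [eval_neg] at this
    linarith

theorem aeval_zero_eq_ofReal (p : ℝ[X]) : aeval (0 : ℂ) p = (p.eval 0 : ℝ) := by
  rw [← map_zero (algebraMap ℝ ℂ), aeval_algebraMap_apply, coe_aeval_eq_eval]
  simp

/-- **Kharitonov's theorem** for families of fixed order. -/
theorem isHurwitz_of_corners {Γ : RealIntervalFamily}
    (horder : (0 : ℝ) ∉ Set.Icc (Γ.lower Γ.order) (Γ.upper Γ.order))
    (hK : ∀ k, IsHurwitz (Γ.corners k)) {p : ℝ[X]} (hp : p ∈ Γ.polys) : IsHurwitz p := by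
  have hK' : ∀ k (s : ℂ), 0 ≤ s.re → ((Γ.corners k).map (algebraMap ℝ ℂ)).eval s ≠ 0 := by
    intro k s hs h0
    rw [eval_map_algebraMap] at h0
    exact absurd (hK k s h0) (not_lt.2 hs)
  have hnonneg : ∀ q ∈ Γ.polys, ∀ ω : ℝ, 0 ≤ ω → aeval (Complex.I * ω) q ≠ 0 := by
    intro q hq ω hω
    refine Γ.isMovingRectangle_corners.ne_zero_of_mem hK' ?_ hω (memMovingRectangle_corners hq hω)
    rcases eval_zero_corners_sign horder hK with h | h
    · refine ⟨3, fun k => ?_⟩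
      simpa [aeval_zero_eq_ofReal, pow_succ] using h k
    · refine ⟨1, fun k => ?_⟩
      simpa [aeval_zero_eq_ofReal] using h k
  have haxis : ∀ q ∈ Γ.polys, ∀ ω : ℝ, aeval (Complex.I * ω) q ≠ 0 := by
    intro q hq ω
    rcases le_total 0 ω with hω | hω
    · exact hnonneg q hq ω hω
    · have := hnonneg q hq (-ω) (by linarith)
      rw [aeval_I_mul_neg] at this
      exact fun h => this (by rw [h, map_zero])
  intro s hs
  by_contra! hre
  -- The segment from a corner to p stays in the family, so it has constant degree and no roots on
  -- the axis.
  refine eval_ne_zero_of_segment (P := (Γ.corners 0).map (algebraMap ℝ ℂ))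
    (Q := p.map (algebraMap ℝ ℂ)) (n := Γ.order) ?_ ?_ ?_ ?_ (hK' 0) hre
    (by rw [eval_map_algebraMap, hs])
  · rw [natDegree_map]; exact natDegree_le (Γ.corners_mem 0)
  · rw [natDegree_map]; exact natDegree_le hp
  · intro t ht h0
    have h1 := coeff_order_mem (convex_combination_mem (Γ.corners_mem 0) hp ht)
    refine horder ?_
    convert! h1
    rw [coeff_map, coeff_map] at h0
    simp only [coeff_add, coeff_C_mul, Complex.coe_algebraMap] at h0 ⊢
    exact_mod_cast h0.symm
  · intro t ht z hz h0
    refine haxis _ (convex_combination_mem (Γ.corners_mem 0) hp ht) z.im ?_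
    have hz' : Complex.I * z.im = z := Complex.ext (by simp [hz]) (by simp)
    rw [hz']
    rw [eval_map_algebraMap, eval_map_algebraMap] at h0
    simpa using h0

/-! ### Zero exclusion for p_u + z p_v -/

/-- The start condition of the zero exclusion principle for the vertices `p + z q`. -/
theorem exists_separating_direction {Γu Γv : RealIntervalFamily}
    (horder : (0 : ℝ) ∉ Set.Icc (Γv.lower Γv.order) (Γv.upper Γv.order))
    (hK : ∀ k, IsHurwitz (Γv.corners k)) (z : ℂ) :
    ∃ m : Fin 4, ∀ i j, IsShiftedSPR z.re (Γu.corners i) (Γv.corners j) →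
      0 < ((starRingEnd ℂ) (Complex.I ^ (m : ℕ)) * ((Γu.corners i).map (algebraMap ℝ ℂ) +
        C z * (Γv.corners j).map (algebraMap ℝ ℂ)).eval 0).im := by
  have hre : ∀ i j, IsShiftedSPR z.re (Γu.corners i) (Γv.corners j) →
      0 < (z.re * (Γv.corners j).eval 0 + (Γu.corners i).eval 0) / (Γv.corners j).eval 0 := by
    intro i j h
    have := h.2.2 0
    rw [Complex.ofReal_zero, mul_zero, aeval_zero_eq_ofReal, aeval_zero_eq_ofReal, ← Complex.ofReal_div, Complex.ofReal_re] at this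
    simpa using this
  -- At ω = 0 all values of p_u and p_v are real. If Im z ≠ 0 the imaginary part Im z · p_v(0) has a
  -- common sign; if z is real, the SPR condition at ω = 0 fixes the sign of the real part.
  rcases eval_zero_corners_sign horder hK with hc | hc <;>
    rcases lt_trichotomy z.im 0 with hz | hz | hz
  · refine ⟨2, fun i j _ => ?_⟩
    simpa [aeval_zero_eq_ofReal] using mul_neg_of_neg_of_pos hz (hc j)
  · refine ⟨3, fun i j h => ?_⟩
    have := (div_pos_iff_of_pos_right (hc j)).1 (hre i j h)
    simp [aeval_zero_eq_ofReal, pow_succ]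
    linarith
  · refine ⟨0, fun i j _ => ?_⟩
    simpa [aeval_zero_eq_ofReal] using mul_pos hz (hc j)
  · refine ⟨0, fun i j _ => ?_⟩
    simpa [aeval_zero_eq_ofReal] using mul_pos_of_neg_of_neg hz (hc j)
  · refine ⟨1, fun i j h => ?_⟩
    have := (div_pos_iff.1 (hre i j h)).resolve_left fun h => absurd h.2 (not_lt.2 (hc j).le)
    simp [aeval_zero_eq_ofReal]
    linarith [this.1]
  · refine ⟨2, fun i j _ => ?_⟩
    simpa [aeval_zero_eq_ofReal] using mul_neg_of_pos_of_neg hz (hc j)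

/-- Zero exclusion for `p_u + z p_v` on the upper half of the imaginary axis. -/
theorem aeval_add_mul_ne_zero {Γu Γv : RealIntervalFamily}
    (horder : (0 : ℝ) ∉ Set.Icc (Γv.lower Γv.order) (Γv.upper Γv.order)) {z : ℂ}
    (h₁ : ∀ k, IsShiftedSPR z.re (Γu.corners k) (Γv.corners (k - 1)))
    (h₃ : ∀ k, IsShiftedSPR z.re (Γu.corners k) (Γv.corners (k + 1)))
    (h₀ : 0 < z.re → ∀ k, IsShiftedSPR z.re (Γu.corners k) (Γv.corners k))
    (h₂ : z.re < 0 → ∀ k, IsShiftedSPR z.re (Γu.corners k) (Γv.corners (k + 2)))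
    {pu pv : ℝ[X]} (hpu : pu ∈ Γu.polys) (hpv : pv ∈ Γv.polys) {ω : ℝ} (hω : 0 ≤ ω) :
    aeval (Complex.I * ω) pu + z * aeval (Complex.I * ω) pv ≠ 0 := by
  have hK : ∀ k, IsHurwitz (Γv.corners k) := fun k => by
    have := (h₁ (k + 1)).2.1
    rwa [add_sub_cancel_right] at this
  obtain ⟨m, hm⟩ := exists_separating_direction (Γu := Γu) horder hK z
  have hu := memMovingRectangle_corners hpu hω
  have hv := memMovingRectangle_corners hpv hω
  set p : ℂ[X] → Prop := fun F => ∃ i j, IsShiftedSPR z.re (Γu.corners i) (Γv.corners j) ∧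
    F = (Γu.corners i).map (algebraMap ℝ ℂ) + C z * (Γv.corners j).map (algebraMap ℝ ℂ)
  have hp : ∀ F, p F → ∀ s : ℂ, 0 ≤ s.re → F.eval s ≠ 0 := by
    rintro _ ⟨i, j, h, rfl⟩ s hs
    exact h.eval_add_mul_ne_zero rfl hs
  have hp0 : ∃ m : Fin 4, ∀ F, p F →
      0 < ((starRingEnd ℂ) (Complex.I ^ (m : ℕ)) * F.eval 0).im := by
    refine ⟨m, ?_⟩
    rintro _ ⟨i, j, h, rfl⟩
    exact hm i j h
  have hpmk : ∀ i j, IsShiftedSPR z.re (Γu.corners i) (Γv.corners j) →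
      p ((Γu.corners i).map (algebraMap ℝ ℂ) + C z * (Γv.corners j).map (algebraMap ℝ ℂ)) :=
    fun i j h => ⟨i, j, h, rfl⟩
  have main := fun (n : Fin 4) (w : ℂ) (hzw : z = Complex.I ^ (n : ℕ) * w) (hre : 0 < w.re)
      (him : 0 ≤ w.im) hW hW' =>
    Γu.isMovingRectangle_corners.add_I_pow_mul_ne_zero_of_mem Γv.isMovingRectangle_corners n hzw
      hre him p hp hp0 hW hW' hω hu hv
  have e₁ : ∀ k : Fin 4, k + 1 + 2 = k - 1 := by decide
  have e₂ : ∀ k : Fin 4, k + 1 + 1 = k - 2 := by decide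
  have e₃ : ∀ k : Fin 4, k + 1 = k - 3 := by decide
  have e₄ : ∀ k : Fin 4, k + 2 = k - 2 := by decide
  -- Four half-open quadrants, permuted by multiplication by i, cover all z ≠ 0; in each, z = i^n w
  -- with w in the first one.
  by_cases c₀ : 0 < z.re ∧ 0 ≤ z.im
  · refine main 0 z (by simp) c₀.1 c₀.2 (fun k => hpmk k _ ?_) fun _ k => hpmk (k + 1) _ ?_
    · simpa using h₀ c₀.1 k
    · simpa using h₁ (k + 1)
  by_cases c₁ : 0 < z.im ∧ z.re ≤ 0
  · refine main 1 (-Complex.I * z) ?_ (by simpa using c₁.1) (by simpa using c₁.2)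
      (fun k => hpmk k _ (h₁ k)) fun h k => hpmk (k + 1) _ ?_
    · simp [← mul_assoc]
    · rw [← e₁]
      exact h₂ (by simpa using h) (k + 1)
  by_cases c₂ : z.re < 0 ∧ z.im ≤ 0
  · refine main 2 (-z) (by simp) (by simpa using c₂.1) (by simpa using c₂.2)
      (fun k => hpmk k _ ?_) fun _ k => hpmk (k + 1) _ ?_
    · rw [← e₄]
      exact h₂ c₂.1 k
    · rw [← e₂]
      exact h₃ (k + 1)
  by_cases c₃ : z.im < 0 ∧ 0 ≤ z.re
  · refine main 3 (Complex.I * z) ?_ (by simpa using c₃.1) (by simpa using c₃.2)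
      (fun k => hpmk k _ ?_) fun h k => hpmk (k + 1) _ ?_
    · simp [pow_succ, ← mul_assoc]
    · rw [← e₃]
      exact h₃ k
    · rw [← e₃]
      exact h₀ (by simpa using h) (k + 1)
  have hz : z = 0 := by
    push Not at c₀ c₁ c₂ c₃
    apply Complex.ext <;> simp only [Complex.zero_re, Complex.zero_im]
    · by_contra h
      rcases lt_or_gt_of_ne h with h | h
      · linarith [c₂ h, c₁ (c₂ h)]
      · linarith [c₀ h, c₃ (c₀ h)]
    · by_contra h
      rcases lt_or_gt_of_ne h with h | h
      · linarith [c₃ h, c₂ (c₃ h)]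
      · linarith [c₁ h, c₀ (c₁ h)]
  -- At z = 0 only the rectangle of Γ_u remains.
  have hW := fun k => hpmk k _ (h₁ k)
  subst hz
  rw [zero_mul, add_zero]
  simp only [C_0, zero_mul, add_zero] at hW
  obtain ⟨m, hm⟩ := hp0
  exact Γu.isMovingRectangle_corners.ne_zero_of_mem (fun k => hp _ (hW k)) ⟨m, fun k => hm _ (hW k)⟩
    hω hu

/-! ### From the vertices to the whole family -/

/-- Strict positive realness of a shifted interval transfer function from its vertices. -/
theorem isShiftedSPR_of_corners {Γu Γv : RealIntervalFamily} (hproper : Γu.order ≤ Γv.order)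
    (horder : (0 : ℝ) ∉ Set.Icc (Γv.lower Γv.order) (Γv.upper Γv.order)) {γ : ℝ}
    (h₁ : ∀ k, IsShiftedSPR γ (Γu.corners k) (Γv.corners (k - 1)))
    (h₃ : ∀ k, IsShiftedSPR γ (Γu.corners k) (Γv.corners (k + 1)))
    (h₀ : 0 < γ → ∀ k, IsShiftedSPR γ (Γu.corners k) (Γv.corners k))
    (h₂ : γ < 0 → ∀ k, IsShiftedSPR γ (Γu.corners k) (Γv.corners (k + 2)))
    {pu pv : ℝ[X]} (hpu : pu ∈ Γu.polys) (hpv : pv ∈ Γv.polys) : IsShiftedSPR γ pu pv := by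
  have hK : ∀ k, IsHurwitz (Γv.corners k) := fun k => by
    have := (h₁ (k + 1)).2.1
    rwa [add_sub_cancel_right] at this
  have hH : ∀ q ∈ Γv.polys, IsHurwitz q := fun q hq => isHurwitz_of_corners horder hK hq
  have hq0 : ∀ q ∈ Γv.polys, ∀ ω : ℝ, aeval (Complex.I * ω) q ≠ 0 := by
    intro q hq ω h0
    simpa using hH q hq _ h0
  have hne : ∀ p ∈ Γu.polys, ∀ q ∈ Γv.polys, ∀ ω : ℝ, 0 ≤ ω →
      (aeval (Complex.I * ω) (C γ * q + p) / aeval (Complex.I * ω) q).re ≠ 0 := by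
    intro p hp q hq ω hω h0
    set x := aeval (Complex.I * ω) (C γ * q + p) / aeval (Complex.I * ω) q with hx
    have hxI : x = Complex.I * x.im := Complex.ext (by simp [h0]) (by simp)
    rw [eq_div_iff (hq0 q hq ω), hxI] at hx
    have hz : (γ - Complex.I * x.im : ℂ).re = γ := by simp
    refine aeval_add_mul_ne_zero (z := γ - Complex.I * x.im) horder (by rwa [hz]) (by rwa [hz])
      (by rwa [hz]) (by rwa [hz]) hp hq hω ?_
    simp only [map_add, map_mul, aeval_C, Complex.coe_algebraMap] at hx
    linear_combination -hx
  have hpos : ∀ ω : ℝ, 0 ≤ ω →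
      0 < (aeval (Complex.I * ω) (C γ * pv + pu) / aeval (Complex.I * ω) pv).re := by
    intro ω hω
    by_contra! hle
    -- f joins the real part at the vertex pair (0, 0 - 1) to that at (pu, pv) through members of
    -- the families; a sign change would give a zero.
    set f : ℝ → ℝ := fun t => (aeval (Complex.I * ω)
      (C γ * (C (1 - t) * Γv.corners (0 - 1) + C t * pv) + (C (1 - t) * Γu.corners 0 + C t * pu)) /
      aeval (Complex.I * ω) (C (1 - t) * Γv.corners (0 - 1) + C t * pv)).re with hf
    have hv := fun t ht => convex_combination_mem (Γv.corners_mem (0 - 1)) hpv (t := t) ht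
    have hu := fun t ht => convex_combination_mem (Γu.corners_mem 0) hpu (t := t) ht
    have hcont : ContinuousOn f (Set.Icc 0 1) := by
      refine Complex.continuous_re.comp_continuousOn (ContinuousOn.div ?_ ?_ fun t ht => hq0 _ (hv t ht) ω)
      all_goals
        simp only [map_add, map_mul, aeval_C, Complex.coe_algebraMap]
        fun_prop
    have hf0 : 0 ≤ f 0 := by simpa [hf] using ((h₁ 0).2.2 ω).le
    have hf1 : f 1 ≤ 0 := by simpa [hf] using hle
    obtain ⟨t, ht, ht0⟩ := intermediate_value_Icc' zero_le_one hcont ⟨hf1, hf0⟩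
    exact hne _ (hu t ht) _ (hv t ht) ω hω ht0
  refine ⟨?_, hH pv hpv, fun ω => ?_⟩
  · rw [natDegree_eq horder hpv]
    refine (natDegree_add_le _ _).trans (max_le ?_ ((natDegree_le hpu).trans hproper))
    exact (natDegree_C_mul_le _ _).trans (natDegree_le hpv)
  · rcases le_total 0 ω with hω | hω
    · exact hpos ω hω
    · have := hpos (-ω) (by linarith)
      rwa [aeval_I_mul_neg, aeval_I_mul_neg, ← map_div₀, Complex.conj_re] at this

end RealIntervalFamily

theorem forall_eightVertices {Γu Γv : RealIntervalFamily} {p : ℝ[X] → ℝ[X] → Prop}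
    (h : ∀ K ∈ eightVertices Γu Γv, p K.1 K.2) :
    (∀ k, p (Γu.corners k) (Γv.corners (k - 1))) ∧
      ∀ k, p (Γu.corners k) (Γv.corners (k + 1)) := by
  simp only [eightVertices, Set.mem_insert_iff, Set.mem_singleton_iff, forall_eq_or_imp,
    forall_eq] at h
  obtain ⟨h14, h23, h31, h42, h13, h24, h32, h41⟩ := h
  constructor <;> intro k <;> fin_cases k <;> assumption

theorem mem_polys_of_mem_vertices {Γu Γv : RealIntervalFamily} {K : ℝ[X] × ℝ[X]}
    (hK : K ∈ twelveVerticesNonneg Γu Γv ∪ twelveVerticesNonpos Γu Γv) :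
    K.1 ∈ Γu.polys ∧ K.2 ∈ Γv.polys := by
  have u1 := Γu.corners_mem 0
  have u3 := Γu.corners_mem 1
  have u2 := Γu.corners_mem 2
  have u4 := Γu.corners_mem 3
  have v1 := Γv.corners_mem 0
  have v3 := Γv.corners_mem 1
  have v2 := Γv.corners_mem 2
  have v4 := Γv.corners_mem 3
  simp only [twelveVerticesNonneg, twelveVerticesNonpos, eightVertices, Set.mem_union,
    Set.mem_insert_iff, Set.mem_singleton_iff] at hK
  rcases hK with ((h | h | h | h | h | h | h | h) | h | h | h | h) |
    ((h | h | h | h | h | h | h | h) | h | h | h | h) <;> subst h <;> constructor <;> assumption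

theorem mainTheorem6 (Γu Γv : RealIntervalFamily)
    (hproper : Γu.order ≤ Γv.order)
    (horder : (0 : ℝ) ∉ Set.Icc (Γv.lower Γv.order) (Γv.upper Γv.order)) :
    ((∀ pu ∈ Γu.polys, ∀ pv ∈ Γv.polys, IsSPR pu pv) ↔
      ∀ K ∈ eightVertices Γu Γv, IsSPR K.1 K.2) ∧
    (∀ γ : ℝ, 0 ≤ γ →
      ((∀ pu ∈ Γu.polys, ∀ pv ∈ Γv.polys, IsShiftedSPR γ pu pv) ↔
        ∀ K ∈ twelveVerticesNonneg Γu Γv, IsShiftedSPR γ K.1 K.2)) ∧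
    (∀ γ : ℝ, γ ≤ 0 →
      ((∀ pu ∈ Γu.polys, ∀ pv ∈ Γv.polys, IsShiftedSPR γ pu pv) ↔
        ∀ K ∈ twelveVerticesNonpos Γu Γv, IsShiftedSPR γ K.1 K.2)) := by
  refine ⟨⟨fun h K hK => ?_, fun h pu hpu pv hpv => ?_⟩,
    fun γ hγ => ⟨fun h K hK => ?_, fun h pu hpu pv hpv => ?_⟩,
    fun γ hγ => ⟨fun h K hK => ?_, fun h pu hpu pv hpv => ?_⟩⟩
  · obtain ⟨h1, h2⟩ := mem_polys_of_mem_vertices (Or.inl (Or.inl hK))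
    exact h _ h1 _ h2
  · have hS : ∀ p q : ℝ[X], IsShiftedSPR 0 p q ↔ IsSPR p q := fun p q => by simp [IsShiftedSPR]
    obtain ⟨h₁, h₃⟩ := forall_eightVertices h
    simp only [← hS] at h₁ h₃ ⊢
    exact RealIntervalFamily.isShiftedSPR_of_corners hproper horder h₁ h₃
      (fun h => absurd h (lt_irrefl _)) (fun h => absurd h (lt_irrefl _)) hpu hpv
  · obtain ⟨h1, h2⟩ := mem_polys_of_mem_vertices (Or.inl hK)
    exact h _ h1 _ h2
  · obtain ⟨h₁, h₃⟩ := forall_eightVertices (p := IsShiftedSPR γ) fun K hK => h K (Or.inl hK)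
    refine RealIntervalFamily.isShiftedSPR_of_corners hproper horder h₁ h₃ (fun _ k => ?_)
      (fun h => absurd h (not_lt.2 hγ)) hpu hpv
    refine h (Γu.corners k, Γv.corners k) (Or.inr ?_)
    fin_cases k <;> simp [RealIntervalFamily.corners]
  · obtain ⟨h1, h2⟩ := mem_polys_of_mem_vertices (Or.inr hK)
    exact h _ h1 _ h2
  · obtain ⟨h₁, h₃⟩ := forall_eightVertices (p := IsShiftedSPR γ) fun K hK => h K (Or.inl hK)
    refine RealIntervalFamily.isShiftedSPR_of_corners hproper horder h₁ h₃
      (fun h => absurd h (not_lt.2 hγ)) (fun _ k => ?_) hpu hpv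
    refine h (Γu.corners k, Γv.corners (k + 2)) (Or.inr ?_)
    fin_cases k <;> simp [RealIntervalFamily.corners]
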